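/- Write $\widehat f(\xi)=(2\pi)^{-1/2}\int_{\mathbb R} e^{-ix\xi}f(x)\,dx$ (extended to $L^2(\mathbb R)$), $\sigma(D)f=\mathcal F^{-1}[\sigma\widehat f\,]$, and, for $m:\mathbb R^2\to\mathbb C$, $$T_m(f,g)=\mathcal F^{-1}\Big[\xi\mapsto\int_{\mathbb R} m(\xi-\eta,\eta)\,\widehat f(\xi-\eta)\,\widehat g(\eta)\,d\eta\Big].$$ Let $a,b,c:\mathbb R\to\mathbb R$ be smooth, with $a'',b'',c''$ each bounded away from zero on $\mathbb R$, and let $m$ be smooth and compactly supported. Put $\mu(\xi,\eta)=m(\xi-\eta,\eta)$, $$\Phi(\xi,\eta)=-a(\xi)+b(\xi-\eta)+c(\eta),\qquad \psi(\xi,\eta,\sigma)=a(\xi)+\sigma\,\Phi(\xi,\eta)+X\xi\quad(X\in\mathbb R\text{ a parameter}).$$ Assume that $\partial_\eta\Phi$ does not vanish on $\operatorname{Supp}\mu$ (no space resonances), and that $\partial_\xi^2\psi=(1-\sigma)a''(\xi)+\sigma b''(\xi-\eta)$ does not vanish on $\operatorname{Supp}\mu\times[0,1]$. Let $f,g\in\mathcal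 S(\mathbb R)$ and let $(u,v,w)$ be the solution, for $t\ge 0$, of $$i\partial_t u+a(D)u=T_m(v,w),\quad i\partial_t v+b(D)v=0,\quad i\partial_t w+c(D)w=0,\qquad u(0)=0,\ v(0)=f,\ w(0)=g,$$ that is, $v(t)=e^{itb(D)}f$, $w(t)=e^{itc(D)}g$ and $u(t)=-i\int_0^t e^{i(t-s)a(D)}T_m(v(s),w(s))\,ds$. Then these Duhamel integrals converge in $L^2(\mathbb R)$. For $M>0$ put $$F_M=-i\int_0^M e^{-isa(D)}\,T_m\big(e^{isb(D)}f,e^{isc(D)}g\big)\,ds .$$ For $t\ge M$, $e^{ita(D)}F_M$ is the value at time $t$ of the solution (given by Duhamel's formula) with zero initial datum of the equation $i\partial_tU+a(D)U=\mathbf 1_{\{t<M\}}T_m(v,w)$. Moreover, for every $N\in\mathbb N$ there is a constant $C$, depending only on $a,b,c,m,f,g,N$, such that for all $M>0$ and all $t\ge M$ $$\big\|u(t)-e^{ita(D)}F_M\big\|_{L^\infty(\mathbb R)}\le\frac{C}{M^N\sqrt t}.$$ -/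

import Mathlib

open MeasureTheory FourierTransform
open scoped ContDiff SchwartzMap ENNReal

noncomputable section

namespace Dispersive

/-- The space `L²(ℝ; ℂ)`. -/
abbrev L2 : Type := Lp ℂ 2 (volume : Measure ℝ)

/-- The unitary Fourier transform in angular frequency,
`f̂(ξ) = (2π)^{-1/2} ∫ e^{-ixξ} f(x) dx`, extended to `L²` (Plancherel). Mathlib's `𝓕` uses the
kernel `e^{-2πixν}`, hence the rescaling `ξ = 2πν`. -/
def hat (f : L2) : ℝ → ℂ :=
  fun ξ => (((√(2 * Real.pi))⁻¹ : ℝ) : ℂ) * ((𝓕 f : L2) : ℝ → ℂ) (ξ / (2 * Real.pi))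

/-- `h(ξ)` written in Mathlib's frequency variable `ν = ξ / 2π`, with the factor that makes
`hat (invHat h) = h`. -/
def rescale (h : ℝ → ℂ) : ℝ → ℂ :=
  fun ν => ((√(2 * Real.pi) : ℝ) : ℂ) * h (2 * Real.pi * ν)

open Classical in
/-- The inverse of `hat`: the function `(2π)^{-1/2} ∫ e^{ixξ} h(ξ) dξ` of `x`, for `h ∈ L²`
(and `0` by convention when `h ∉ L²`, which does not occur for the operators below: see `hat_propagator`, `hat_pseudoProduct`). -/
def invHat (h : ℝ → ℂ) : L2 :=
  if H : MemLp (rescale h) 2 volume then 𝓕⁻ (H.toLp (rescale h)) else 0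

/-- The Fourier multiplier `σ(D) f = 𝓕⁻¹[σ 𝓕 f]`. -/
def multiplier (σ : ℝ → ℂ) (f : L2) : L2 := invHat (fun ξ => σ ξ * hat f ξ)

/-- The group `e^{ita(D)}`. -/
def propagator (a : ℝ → ℝ) (t : ℝ) (f : L2) : L2 :=
  multiplier (fun ξ => Complex.exp (Complex.I * ((t * a ξ : ℝ) : ℂ))) f

/-- The bilinear multiplier
`T_m(f,g) = 𝓕⁻¹[ξ ↦ ∫ m(ξ-η,η) f̂(ξ-η) ĝ(η) dη]`. -/
def pseudoProduct (m : ℝ × ℝ → ℂ) (f g : L2) : L2 :=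
  invHat (fun ξ => ∫ η, m (ξ - η, η) * hat f (ξ - η) * hat g η)

/-- The mild (Duhamel) solution of `i∂_t u + a(D)u = G`, `u(0) = 0`:
`u(t) = -i ∫_0^t e^{i(t-s)a(D)} G(s) ds`, an `L²`-valued integral. -/
def duhamel (a : ℝ → ℝ) (G : ℝ → L2) (t : ℝ) : L2 :=
  -Complex.I • ∫ s in (0 : ℝ)..t, propagator a (t - s) (G s)

/-- The `L²` datum `-i ∫_0^M e^{-isa(D)} G(s) ds`, an `L²`-valued integral. -/
def truncatedProfile (a : ℝ → ℝ) (G : ℝ → L2) (M : ℝ) : L2 :=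
  -Complex.I • ∫ s in (0 : ℝ)..M, propagator a (-s) (G s)

/-- `(u, v, w)` is the (mild) solution, for nonnegative times, of
`i∂_t u + a(D)u = T_m(v,w)`, `i∂_t v + b(D)v = 0`, `i∂_t w + c(D)w = 0`
with data `u(0) = 0`, `v(0) = f`, `w(0) = g`. -/
structure IsSolution (a b c : ℝ → ℝ) (m : ℝ × ℝ → ℂ) (f g : L2) (u v w : ℝ → L2) : Prop where
  eq_v : ∀ t, 0 ≤ t → v t = propagator b t f
  eq_w : ∀ t, 0 ≤ t → w t = propagator c t g
  eq_u : ∀ t, 0 ≤ t → u t = duhamel a (fun s => pseudoProduct m (v s) (w s)) t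

/-- `Φ(ξ,η) = -a(ξ) + b(ξ-η) + c(η)`; here `ξ` is the output frequency, `ξ-η` and `η` are the
input frequencies. -/
def Phi (a b c : ℝ → ℝ) (ξ η : ℝ) : ℝ := -a ξ + b (ξ - η) + c η

/-- `ψ(ξ,η,σ) = a(ξ) + σ Φ(ξ,η) + X ξ`, where `X = x/t` is a parameter. -/
def psi (a b c : ℝ → ℝ) (X ξ η σ : ℝ) : ℝ := a ξ + σ * Phi a b c ξ η + X * ξ

/-- The second derivative of `a` is bounded away from zero. -/
def SecondDerivBoundedAway (a : ℝ → ℝ) : Prop :=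
  ∃ δ : ℝ, 0 < δ ∧ ∀ ξ : ℝ, δ ≤ |iteratedDeriv 2 a ξ|

/-- The support of the symbol in the variables `(ξ,η)` of `Φ` and `ψ`, that is, the (closed)
support of `μ(ξ,η) = m(ξ-η,η)`. -/
def symbolSupport (m : ℝ × ℝ → ℂ) : Set (ℝ × ℝ) := {p | (p.1 - p.2, p.2) ∈ tsupport m}

/-! ### The conventions above are not degenerate -/

theorem memLp_comp_mul {h : ℝ → ℂ} {r : ℝ} (hr : r ≠ 0) (hh : MemLp h 2 volume) :
    MemLp (fun x => h (r * x)) 2 volume := by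
  have hmap : Measure.map (fun x : ℝ => r * x) volume = ENNReal.ofReal |r⁻¹| • volume :=
    Real.map_volume_mul_left hr
  have h1 : MemLp h 2 (Measure.map (fun x : ℝ => r * x) volume) := by
    rw [hmap]; exact hh.smul_measure ENNReal.ofReal_ne_top
  exact h1.comp_of_map (by fun_prop)

theorem memLp_rescale {h : ℝ → ℂ} (hh : MemLp h 2 volume) : MemLp (rescale h) 2 volume :=
  (memLp_comp_mul (by positivity) hh).const_mul _

theorem memLp_hat (f : L2) : MemLp (hat f) 2 volume := by
  have h := (memLp_comp_mul (r := (2 * Real.pi)⁻¹) (by positivity) (Lp.memLp (𝓕 f : L2))).const_mul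
    (((√(2 * Real.pi))⁻¹ : ℝ) : ℂ)
  convert! h using 2 with ξ
  simp [hat, div_eq_inv_mul]

theorem hat_invHat {h : ℝ → ℂ} (hh : MemLp h 2 volume) : hat (invHat h) =ᵐ[volume] h := by
  have H := memLp_rescale hh
  have e : (𝓕 (invHat h) : L2) = H.toLp (rescale h) := by
    rw [invHat, dif_pos H]; exact fourier_fourierInv_eq _
  have h1 : ((𝓕 (invHat h) : L2) : ℝ → ℂ) =ᵐ[volume] rescale h := by
    rw [e]; exact H.coeFn_toLp
  have hq : Measure.QuasiMeasurePreserving (fun ξ : ℝ => (2 * Real.pi)⁻¹ * ξ) volume volume := by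
    refine ⟨by fun_prop, ?_⟩
    rw [Real.map_volume_mul_left (by positivity)]
    exact Measure.smul_absolutelyContinuous
  have h2 := hq.ae_eq_comp h1
  filter_upwards [h2] with ξ hξ
  simp only [Function.comp_apply] at hξ
  have hs : ((√(2 * Real.pi) : ℝ) : ℂ) ≠ 0 := by
    exact_mod_cast (by positivity : (√(2 * Real.pi)) ≠ 0)
  have hp : 2 * Real.pi * ((2 * Real.pi)⁻¹ * ξ) = ξ := by
    have := Real.pi_pos
    field_simp
  rw [hat, div_eq_inv_mul, hξ, rescale, hp, Complex.ofReal_inv, inv_mul_cancel_left₀ hs]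

theorem hat_propagator {a : ℝ → ℝ} (ha : Continuous a) (t : ℝ) (f : L2) :
    hat (propagator a t f) =ᵐ[volume]
      fun ξ => Complex.exp (Complex.I * ((t * a ξ : ℝ) : ℂ)) * hat f ξ := by
  apply hat_invHat
  refine (memLp_hat f).of_le (f := fun ξ => _) ?_ ?_
  · exact (Continuous.aestronglyMeasurable (by fun_prop)).mul (memLp_hat f).1
  · refine Filter.Eventually.of_forall fun ξ => ?_
    have h1 : ‖Complex.exp (Complex.I * ((t * a ξ : ℝ) : ℂ))‖ = 1 := by
      rw [mul_comm Complex.I, Complex.norm_exp_ofReal_mul_I]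
    rw [norm_mul]
    exact (congrArg (· * ‖hat f ξ‖) h1).le.trans (one_mul _).le

theorem hat_pseudoProduct {m : ℝ × ℝ → ℂ} (hm : Continuous m) (hmc : HasCompactSupport m)
    (f g : L2) : hat (pseudoProduct m f g) =ᵐ[volume]
      fun ξ => ∫ η, m (ξ - η, η) * hat f (ξ - η) * hat g η := by
  apply hat_invHat
  have hf := memLp_hat f
  have hg := memLp_hat g
  obtain ⟨B, hB⟩ := hm.bounded_above_of_compact_support hmc
  obtain ⟨R, hR⟩ := hmc.isBounded.subset_closedBall (0 : ℝ × ℝ)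
  have hsm : ∀ k : L2, StronglyMeasurable (hat k) := fun k =>
    ((Lp.stronglyMeasurable (𝓕 k : L2)).comp_measurable (by fun_prop)).const_mul _
  have hmeas : StronglyMeasurable fun ξ : ℝ => ∫ η, m (ξ - η, η) * hat f (ξ - η) * hat g η := by
    refine StronglyMeasurable.integral_prod_right
      (f := fun ξ η : ℝ => m (ξ - η, η) * hat f (ξ - η) * hat g η) ?_
    refine ((Continuous.stronglyMeasurable (by fun_prop)).mul ?_).mul ?_
    · exact (hsm f).comp_measurable (by fun_prop)
    · exact (hsm g).comp_measurable (by fun_prop)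
  have hzero : ∀ ξ : ℝ, ξ ∉ Set.Icc (-(2 * R)) (2 * R) →
      (∫ η, m (ξ - η, η) * hat f (ξ - η) * hat g η) = 0 := by
    intro ξ hξ
    have : ∀ η : ℝ, m (ξ - η, η) = 0 := by
      intro η
      by_contra hne
      have h1 := hR (subset_tsupport m hne)
      rw [mem_closedBall_zero_iff, Prod.norm_def, max_le_iff] at h1
      simp only [Real.norm_eq_abs, abs_le] at h1
      exact hξ ⟨by linarith [h1.1.1, h1.2.1], by linarith [h1.1.2, h1.2.2]⟩
    simp [this]
  set K : ℝ := B * ((∫ η, ‖hat f η‖ ^ 2) + ∫ η, ‖hat g η‖ ^ 2) with hK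
  have hbd : ∀ ξ : ℝ, ‖∫ η, m (ξ - η, η) * hat f (ξ - η) * hat g η‖ ≤ K := by
    intro ξ
    have hB0 : 0 ≤ B := (norm_nonneg _).trans (hB 0)
    have i1 : Integrable (fun η => ‖hat f (ξ - η)‖ ^ 2) volume :=
      (hf.integrable_norm_pow (p := 2) (by norm_num)).comp_sub_left ξ
    have i2 : Integrable (fun η => ‖hat g η‖ ^ 2) volume :=
      hg.integrable_norm_pow (p := 2) (by norm_num)
    have hle : ∀ η : ℝ, ‖m (ξ - η, η) * hat f (ξ - η) * hat g η‖
        ≤ B * (‖hat f (ξ - η)‖ ^ 2 + ‖hat g η‖ ^ 2) := by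
      intro η
      rw [norm_mul, norm_mul, mul_assoc]
      refine mul_le_mul (hB _) ?_ (by positivity) hB0
      nlinarith [sq_nonneg (‖hat f (ξ - η)‖ - ‖hat g η‖), sq_nonneg (‖hat f (ξ - η)‖),
        sq_nonneg (‖hat g η‖)]
    refine (norm_integral_le_of_norm_le ((i1.add i2).const_mul B)
      (Filter.Eventually.of_forall hle)).trans (le_of_eq ?_)
    simp only [Pi.add_apply]
    rw [integral_const_mul, integral_add i1 i2,
      integral_sub_left_eq_self (fun η => ‖hat f η‖ ^ 2) volume ξ]
  have hfin : MemLp ((Set.Icc (-(2 * R)) (2 * R)).indicator fun _ : ℝ => K) 2 volume :=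
    memLp_indicator_const 2 measurableSet_Icc K (Or.inr measure_Icc_lt_top.ne)
  refine hfin.of_le hmeas.aestronglyMeasurable (Filter.Eventually.of_forall fun ξ => ?_)
  by_cases hξ : ξ ∈ Set.Icc (-(2 * R)) (2 * R)
  · rw [Set.indicator_of_mem hξ]
    exact (hbd ξ).trans (le_abs_self K)
  · rw [hzero ξ hξ]; simp

end Dispersive

end

/-! In Fourier variables `e^{i(t-s)a(D)} T_m(v(s), w(s))` is `e^{ita(ξ)} ∫ e^{isΦ(ξ,η)} A(ξ,η) dη`,
where `A(ξ,η) = m(ξ-η,η) f̂(ξ-η) ĝ(η)` is smooth and compactly supported. The difference `u(t) -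
e^{ita(D)} F_M` is `-i` times the integral of this over `M ≤ s ≤ t`, so it suffices to bound the
integrand in `L^∞` by `C_k s^{-k} t^{-1/2}` for every `k`.

The two decay factors come from different variables. Since `∂_η Φ ≠ 0` on the support, each
integration by parts in `η` gains `1/s` and only replaces `A` by another amplitude, independent of
`s` and supported in the same set (`exists_amplitude_pow_mul_integral_exp`). Then, with `η` frozen,
the phase in `ξ` is `xξ + t a(ξ) + s Φ(ξ,η) = t ψ` with `X = x/t` and `σ = s/t ∈ [0,1]`. Its second
derivative `t ∂_ξ² ψ` is at least a constant times `t` by compactness, and Van der Corput's estimate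
gives `t^{-1/2}` uniformly in `x`, `s` and `η` (`norm_integral_exp_le_of_le_abs`,
`exists_norm_integral_phase_le`).

All output frequencies lie in one compact set `K`, so the time integrals can be taken in `C(K, ℂ)`,
where the integrand is continuous. Bounded operators, into `L²` (`synthesis`) or to the value at a
point (`synthesisAt`), then commute with these integrals. -/

noncomputable section

namespace Dispersive

/-! ### Van der Corput's estimate -/

/-- Van der Corput's second-derivative estimate, with an amplitude and without boundary
conditions. -/
theorem norm_integral_exp_le_of_le {p q l B B' : ℝ} (hpq : p ≤ q) (hl : 0 < l)
    {φ φ' φ'' : ℝ → ℝ} {h h' : ℝ → ℂ}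
    (hφ : ∀ x, HasDerivAt φ (φ' x) x) (hφ' : ∀ x, HasDerivAt φ' (φ'' x) x)
    (hc : Continuous φ'') (hφ'' : ∀ x ∈ Set.Icc p q, l ≤ φ'' x)
    (hh : ∀ x, HasDerivAt h (h' x) x) (hch : Continuous h')
    (hB : ∀ x, ‖h x‖ ≤ B) (hB' : ∀ x, ‖h' x‖ ≤ B') :
    ‖∫ x in p..q, Complex.exp (Complex.I * (φ x : ℂ)) * h x‖ ≤
      (8 * B + B' * (q - p)) / √l := by
  have hs : 0 < √l := Real.sqrt_pos.2 hl
  have hss : √l * √l = l := Real.mul_self_sqrt hl.le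
  have cφ : Continuous φ := continuous_iff_continuousAt.2 fun x => (hφ x).continuousAt
  have cφ' : Continuous φ' := continuous_iff_continuousAt.2 fun x => (hφ' x).continuousAt
  have ch : Continuous h := continuous_iff_continuousAt.2 fun x => (hh x).continuousAt
  have hB0 : 0 ≤ B := (norm_nonneg _).trans (hB p)
  have hB'0 : 0 ≤ B' := (norm_nonneg _).trans (hB' p)
  -- Integration by parts would use `1/φ'`, singular at a stationary point. The regularization `G =
  -- φ'/(l + φ'^2)` needs no splitting of the interval; its cost is the term `l/D = 1 - G φ'` in the
  -- remainder `r`.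
  set D : ℝ → ℝ := fun x => l + φ' x ^ 2 with hD
  have Dpos : ∀ x, 0 < D x := fun x => by positivity
  have Dne : ∀ x, D x ≠ 0 := fun x => (Dpos x).ne'
  have cD : Continuous D := by fun_prop
  set G : ℝ → ℝ := fun x => φ' x / D x with hG
  set G' : ℝ → ℝ := fun x => φ'' x * (l - φ' x ^ 2) / D x ^ 2 with hG'
  have dG : ∀ x, HasDerivAt G (G' x) x := by
    intro x
    have h1 : HasDerivAt D (2 * φ' x * φ'' x) x := by
      convert! ((hφ' x).pow 2).const_add l using 1
      simp
    have h2 := (hφ' x).div h1 (Dne x)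
    convert! h2 using 1
    simp only [hG', hD]
    ring
  have cG : Continuous G := cφ'.div cD Dne
  have cG' : Continuous G' :=
    (hc.mul (continuous_const.sub (cφ'.pow 2))).div (cD.pow 2) fun x => pow_ne_zero 2 (Dne x)
  -- Both `l/D` and `|G'|` are at most `φ''/D`, whose primitive is `θ/√l`: the integral is at most
  -- `π/√l`, whatever the length of the interval.
  set θ : ℝ → ℝ := fun x => Real.arctan (φ' x / √l) with hθ
  have dθ : ∀ x, HasDerivAt θ (√l * (φ'' x / D x)) x := by
    intro x
    have h2 := ((hφ' x).div_const (√l)).arctan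
    convert! h2 using 1
    have : 1 + (φ' x / √l) ^ 2 = D x / l := by
      rw [div_pow, Real.sq_sqrt hl.le, hD]; field_simp
    rw [this]
    have := Dne x
    field_simp
    rw [Real.sq_sqrt hl.le, mul_comm]
  set e : ℝ → ℂ := fun x => Complex.exp (Complex.I * (φ x : ℂ)) with he
  have de : ∀ x, HasDerivAt e (e x * (Complex.I * (φ' x : ℂ))) x := fun x =>
    (((hφ x).ofReal_comp).const_mul Complex.I).cexp
  have ce : Continuous e := by fun_prop
  have ne : ∀ x, ‖e x‖ = 1 := fun x => by
    simp only [he, mul_comm Complex.I, Complex.norm_exp_ofReal_mul_I]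
  set F : ℝ → ℂ := fun x => -Complex.I * (e x * ((G x : ℂ) * h x)) with hF
  set r : ℝ → ℂ := fun x => e x * (((l / D x : ℝ) : ℂ) * h x) +
    Complex.I * (e x * ((G' x : ℂ) * h x + (G x : ℂ) * h' x)) with hr
  have dF : ∀ x, HasDerivAt F (e x * h x - r x) x := by
    intro x
    have h1 := ((de x).mul (((dG x).ofReal_comp).mul (hh x))).const_mul (-Complex.I)
    convert! h1 using 1
    have h2 : ((l / D x : ℝ) : ℂ) = 1 - (G x : ℂ) * φ' x := by
      rw [← Complex.ofReal_mul, ← Complex.ofReal_one, ← Complex.ofReal_sub]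
      congr 1
      have := Dne x
      simp only [hG]
      field_simp
      simp only [hD]; ring
    simp only [hr, Pi.mul_apply]
    rw [h2]
    linear_combination ((e x * φ' x * (G x) * h x)) * Complex.I_mul_I
  have cr : Continuous r := by
    have c1 : Continuous fun x => l / D x := continuous_const.div cD Dne
    simp only [hr]
    fun_prop
  have key : ∫ x in p..q, e x * h x = (F q - F p) + ∫ x in p..q, r x := by
    have h1 := intervalIntegral.integral_eq_sub_of_hasDerivAt (a := p) (b := q)
      (fun x _ => dF x) (Continuous.intervalIntegrable (by fun_prop) p q)
    rw [← h1, intervalIntegral.integral_sub (Continuous.intervalIntegrable (by fun_prop) p q)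
      (cr.intervalIntegrable p q)]
    simp
  have Gb : ∀ x, |G x| ≤ 1 / (2 * √l) := by
    intro x
    rw [hG, abs_div, abs_of_pos (Dpos x), div_le_div_iff₀ (Dpos x) (by positivity)]
    simp only [hD]
    nlinarith [sq_nonneg (√l - |φ' x|), sq_abs (φ' x)]
  have Fb : ∀ x, ‖F x‖ ≤ 1 / (2 * √l) * B := by
    intro x
    simp only [hF, norm_mul, norm_neg, Complex.norm_I, ne, one_mul, Complex.norm_real,
      Real.norm_eq_abs]
    exact mul_le_mul (Gb x) (hB x) (norm_nonneg _) (by positivity)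
  have rb : ∀ x ∈ Set.Icc p q,
      ‖r x‖ ≤ 2 * B / √l * (√l * (φ'' x / D x)) + 1 / (2 * √l) * B' := by
    intro x hx
    have hlx := hφ'' x hx
    have e1 : ‖e x * (((l / D x : ℝ) : ℂ) * h x)‖ ≤ φ'' x / D x * B := by
      rw [norm_mul, ne, one_mul, norm_mul, Complex.norm_real, Real.norm_eq_abs,
        abs_of_pos (div_pos hl (Dpos x))]
      have := Dpos x
      exact mul_le_mul (by gcongr) (hB x) (norm_nonneg _)
        (div_nonneg (hl.le.trans hlx) this.le)
    have e2 : ‖(G' x : ℂ) * h x‖ ≤ φ'' x / D x * B := by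
      rw [norm_mul, Complex.norm_real, Real.norm_eq_abs]
      refine mul_le_mul ?_ (hB x) (norm_nonneg _) (div_nonneg (hl.le.trans hlx) (Dpos x).le)
      have h1 : |l - φ' x ^ 2| ≤ D x := by
        rw [abs_le]; constructor <;> simp only [hD] <;> nlinarith [sq_nonneg (φ' x)]
      rw [hG', abs_div, abs_mul, abs_of_pos (hl.trans_le hlx), abs_of_pos (pow_pos (Dpos x) 2),
        div_le_div_iff₀ (pow_pos (Dpos x) 2) (Dpos x)]
      have := Dpos x
      calc φ'' x * |l - φ' x ^ 2| * D x ≤ φ'' x * D x * D x := by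
            have := hl.le.trans hlx
            gcongr
        _ = _ := by ring
    have e3 : ‖(G x : ℂ) * h' x‖ ≤ 1 / (2 * √l) * B' := by
      rw [norm_mul, Complex.norm_real, Real.norm_eq_abs]
      exact mul_le_mul (Gb x) (hB' x) (norm_nonneg _) (by positivity)
    have e4 : ‖Complex.I * (e x * ((G' x : ℂ) * h x + (G x : ℂ) * h' x))‖ ≤
        φ'' x / D x * B + 1 / (2 * √l) * B' := by
      rw [norm_mul, norm_mul, Complex.norm_I, ne, one_mul, one_mul]
      exact (norm_add_le _ _).trans (add_le_add e2 e3)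
    have e5 : 2 * B / √l * (√l * (φ'' x / D x)) = φ'' x / D x * B + φ'' x / D x * B := by
      field_simp; ring
    rw [e5, add_assoc]
    exact (norm_add_le _ _).trans (add_le_add e1 e4)
  have cθ : Continuous fun x => √l * (φ'' x / D x) := continuous_const.mul (hc.div cD Dne)
  have Ib : ‖∫ x in p..q, r x‖ ≤ 2 * B / √l * (θ q - θ p) + 1 / (2 * √l) * B' * (q - p) := by
    have h1 : Continuous fun x =>
        2 * B / √l * (√l * (φ'' x / D x)) + 1 / (2 * √l) * B' := by fun_prop
    have h2 := intervalIntegral.norm_integral_le_of_norm_le hpq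
      (μ := volume) (f := r)
      (Filter.Eventually.of_forall fun x hx => rb x ⟨hx.1.le, hx.2⟩) (h1.intervalIntegrable p q)
    refine h2.trans (le_of_eq ?_)
    rw [intervalIntegral.integral_add (Continuous.intervalIntegrable (by fun_prop) _ _) (by simp),
      intervalIntegral.integral_const_mul, intervalIntegral.integral_eq_sub_of_hasDerivAt
        (fun x _ => dθ x) (cθ.intervalIntegrable p q), intervalIntegral.integral_const, smul_eq_mul]
    ring
  -- The crude bound `π ≤ 7/2` makes the final constant an integer: `8 = 1 + 2 * (7/2)`, with `1`
  -- from the two boundary terms.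
  have hπ : θ q - θ p ≤ 7 / 2 := by
    have h1 := Real.arctan_lt_pi_div_two (φ' q / √l)
    have h2 := Real.neg_pi_div_two_lt_arctan (φ' p / √l)
    have h3 := Real.pi_lt_d2
    simp only [hθ]
    linarith
  calc ‖∫ x in p..q, e x * h x‖ ≤ (1 / (2 * √l) * B + 1 / (2 * √l) * B) +
        (2 * B / √l * (7 / 2) + 1 / (2 * √l) * B' * (q - p)) := by
        rw [key]
        refine (norm_add_le _ _).trans (add_le_add ((norm_sub_le _ _).trans
          (add_le_add (Fb q) (Fb p))) (Ib.trans ?_))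
        gcongr
    _ = (8 * B + B' * (q - p) / 2) / √l := by field_simp; ring
    _ ≤ _ := by
        have := mul_nonneg hB'0 (sub_nonneg.2 hpq)
        gcongr
        linarith

/-- By the intermediate value theorem `φ''` has constant sign on the interval; complex conjugation
reverses the sign of the phase, which reduces the negative case to the positive one. -/
theorem norm_integral_exp_le_of_le_abs {p q l B B' : ℝ} (hpq : p ≤ q) (hl : 0 < l)
    {φ φ' φ'' : ℝ → ℝ} {h h' : ℝ → ℂ}
    (hφ : ∀ x, HasDerivAt φ (φ' x) x) (hφ' : ∀ x, HasDerivAt φ' (φ'' x) x)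
    (hc : Continuous φ'') (hφ'' : ∀ x ∈ Set.Icc p q, l ≤ |φ'' x|)
    (hh : ∀ x, HasDerivAt h (h' x) x) (hch : Continuous h')
    (hB : ∀ x, ‖h x‖ ≤ B) (hB' : ∀ x, ‖h' x‖ ≤ B') :
    ‖∫ x in p..q, Complex.exp (Complex.I * (φ x : ℂ)) * h x‖ ≤
      (8 * B + B' * (q - p)) / √l := by
  have hne : ∀ x ∈ Set.Icc p q, φ'' x ≠ 0 := fun x hx h0 => by
    have := hφ'' x hx
    rw [h0, abs_zero] at this
    exact absurd this (not_le.2 hl)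
  have hsign : (∀ x ∈ Set.Icc p q, 0 < φ'' x) ∨ ∀ x ∈ Set.Icc p q, φ'' x < 0 := by
    by_contra! hcon
    obtain ⟨⟨x, hx, hx0⟩, y, hy, hy0⟩ := hcon
    obtain ⟨z, hz, hz0⟩ := isPreconnected_Icc.intermediate_value hx hy hc.continuousOn ⟨hx0, hy0⟩
    exact hne z hz hz0
  rcases hsign with hs | hs
  · exact norm_integral_exp_le_of_le hpq hl hφ hφ' hc
      (fun x hx => (hφ'' x hx).trans_eq (abs_of_pos (hs x hx))) hh hch hB hB'
  · have h1 := norm_integral_exp_le_of_le (φ := fun x => -φ x) (φ' := fun x => -φ' x)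
      (φ'' := fun x => -φ'' x) (h := fun x => (starRingEnd ℂ) (h x))
      (h' := fun x => (starRingEnd ℂ) (h' x)) hpq hl (fun x => (hφ x).neg) (fun x => (hφ' x).neg)
      hc.neg (fun x hx => (hφ'' x hx).trans_eq (abs_of_neg (hs x hx)))
      (fun x => by simpa using (hh x).star) (Complex.continuous_conj.comp hch)
      (fun x => by simpa using hB x) (fun x => by simpa using hB' x)
    refine le_trans (le_of_eq ?_) h1
    rw [← Complex.norm_conj, ← intervalIntegral.intervalIntegral_conj]
    simp [← Complex.exp_conj]

/-! ### Pointwise formulas for the `L²` Fourier transform -/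

/-- The inverse Fourier transform on `L²` is given by the Fourier integral on `L¹ ∩ L²`. -/
theorem fourierInv_toLp_ae {k : ℝ → ℂ} (h1 : Integrable k) (h2 : MemLp k 2 volume) :
    ((𝓕⁻ (h2.toLp k) : L2) : ℝ → ℂ) =ᵐ[volume] 𝓕⁻ k := by
  have hc : Continuous (𝓕⁻ k) := by
    have : 𝓕⁻ k = fun x => 𝓕 k (-x) := funext fun x => Real.fourierInv_eq_fourier_neg k x
    rw [this]
    exact (VectorFourier.fourierIntegral_continuous Real.continuous_fourierChar
      (innerSL ℝ).continuous₂ h1).comp continuous_neg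
  apply ae_eq_of_integral_contDiff_smul_eq
  · exact (Lp.memLp _).locallyIntegrable (by norm_num)
  · exact hc.locallyIntegrable
  intro g g_smooth g_cpt
  have hg₁ : HasCompactSupport (Complex.ofRealCLM ∘ g) := g_cpt.comp_left rfl
  have hg₂ : ContDiff ℝ ∞ (Complex.ofRealCLM ∘ g) := by fun_prop
  set G : 𝓢(ℝ, ℂ) := hg₁.toSchwartzMap hg₂ with hG
  have hGg : ∀ x, G x = (g x : ℂ) := fun x => rfl
  have e1 : ∫ x, g x • ((𝓕⁻ (h2.toLp k) : L2) : ℝ → ℂ) x =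
      Lp.toTemperedDistribution (𝓕⁻ (h2.toLp k)) G := by
    rw [Lp.toTemperedDistribution_apply]
    simp [hGg]
  rw [e1, ← Lp.fourierInv_toTemperedDistribution_eq, TemperedDistribution.fourierInv_apply,
    Lp.toTemperedDistribution_apply]
  have e2 : ∫ x, (𝓕⁻ G) x • ((h2.toLp k : L2) : ℝ → ℂ) x = ∫ x, (𝓕⁻ G) x • k x := by
    apply integral_congr_ae
    filter_upwards [h2.coeFn_toLp] with x hx
    rw [hx]
  rw [e2]
  -- The multiplication formula (Fubini) moves the inverse transform from the test function back to
  -- `k`; the pairing `-⟨·,·⟩` is the one for the inverse transform, and it is symmetric.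
  have e3 := VectorFourier.integral_fourierIntegral_smul_eq_flip (L := -innerₗ ℝ)
    (f := G) (g := k) (μ := volume) (ν := volume) Real.continuous_fourierChar
    (by
      show Continuous fun p : ℝ × ℝ => -(inner ℝ p.1 p.2)
      exact continuous_inner.neg) G.integrable h1
  have e4 : (-innerₗ ℝ : ℝ →ₗ[ℝ] ℝ →ₗ[ℝ] ℝ).flip = -innerₗ ℝ := by
    ext; simp
  rw [e4] at e3
  rw [SchwartzMap.fourierInv_coe]
  refine Eq.trans e3 ?_
  refine integral_congr_ae (Filter.Eventually.of_forall fun x => ?_)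
  simp only [hGg, Complex.real_smul]
  rfl

theorem invHat_congr_ae {h k : ℝ → ℂ} (hk : h =ᵐ[volume] k) : invHat h = invHat k := by
  have hq : Measure.QuasiMeasurePreserving (fun ξ : ℝ => 2 * Real.pi * ξ) volume volume := by
    refine ⟨by fun_prop, ?_⟩
    rw [Real.map_volume_mul_left (by positivity)]
    exact Measure.smul_absolutelyContinuous
  have hr : rescale h =ᵐ[volume] rescale k := by
    filter_upwards [hq.ae_eq_comp hk] with ν hν
    simp only [Function.comp_apply] at hν
    simp only [rescale, hν]
  by_cases H : MemLp (rescale h) 2 volume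
  · have K : MemLp (rescale k) 2 volume := (memLp_congr_ae hr).1 H
    rw [invHat, invHat, dif_pos H, dif_pos K]
    congr 1
    exact (MemLp.toLp_eq_toLp_iff H K).2 hr
  · have K : ¬ MemLp (rescale k) 2 volume := fun K => H ((memLp_congr_ae hr).2 K)
    rw [invHat, invHat, dif_neg H, dif_neg K]

theorem propagator_invHat (a : ℝ → ℝ) (t : ℝ) {h : ℝ → ℂ} (hh : MemLp h 2 volume) :
    propagator a t (invHat h) =
      invHat fun ξ => Complex.exp (Complex.I * ((t * a ξ : ℝ) : ℂ)) * h ξ := by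
  apply invHat_congr_ae
  filter_upwards [hat_invHat hh] with ξ hξ
  rw [hξ]

theorem invHat_ae {h : ℝ → ℂ} (h1 : Integrable h) (h2 : MemLp h 2 volume) :
    (invHat h : ℝ → ℂ) =ᵐ[volume] fun x =>
      (((√(2 * Real.pi))⁻¹ : ℝ) : ℂ) * ∫ ξ, Complex.exp (Complex.I * ((x * ξ : ℝ) : ℂ)) * h ξ := by
  have H := memLp_rescale h2
  have H1 : Integrable (rescale h) :=
    (h1.comp_mul_left' (by positivity : 2 * Real.pi ≠ 0)).const_mul _
  rw [invHat, dif_pos H]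
  filter_upwards [fourierInv_toLp_ae H1 H] with x hx
  rw [hx, Real.fourierInv_eq']
  have e1 : ∀ v : ℝ, Complex.exp (((2 * Real.pi * inner ℝ v x : ℝ) : ℂ) * Complex.I) •
      rescale h v = ((√(2 * Real.pi) : ℝ) : ℂ) *
        (fun ξ => Complex.exp (Complex.I * ((x * ξ : ℝ) : ℂ)) * h ξ) (2 * Real.pi * v) := by
    intro v
    simp only [rescale, smul_eq_mul]
    have : ((2 * Real.pi * inner ℝ v x : ℝ) : ℂ) * Complex.I =
        Complex.I * ((x * (2 * Real.pi * v) : ℝ) : ℂ) := by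
      simp only [RCLike.inner_apply]
      simp
      ring
    rw [this]
    ring
  rw [integral_congr_ae (Filter.Eventually.of_forall e1), integral_const_mul,
    Measure.integral_comp_mul_left
      (fun ξ => Complex.exp (Complex.I * ((x * ξ : ℝ) : ℂ)) * h ξ) (2 * Real.pi), abs_of_pos (by positivity),
    Complex.real_smul, ← mul_assoc, ← Complex.ofReal_mul]
  congr 2
  have h0 : (0 : ℝ) ≤ 2 * Real.pi := by positivity
  rw [inv_eq_one_div, inv_eq_one_div, mul_one_div, div_eq_div_iff (by positivity) (by positivity),
    Real.mul_self_sqrt h0, one_mul]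

/-- The Fourier transform, in angular frequency, of a Schwartz function. -/
def angularFourier (f : 𝓢(ℝ, ℂ)) (ξ : ℝ) : ℂ :=
  (((√(2 * Real.pi))⁻¹ : ℝ) : ℂ) * (𝓕 f) (ξ / (2 * Real.pi))

theorem contDiff_angularFourier (f : 𝓢(ℝ, ℂ)) : ContDiff ℝ ∞ (angularFourier f) :=
  contDiff_const.mul (((𝓕 f).smooth ⊤).comp (contDiff_id.div_const _))

theorem hat_toLp_ae (f : 𝓢(ℝ, ℂ)) : hat (f.toLp 2) =ᵐ[volume] angularFourier f := by
  have hq : Measure.QuasiMeasurePreserving (fun ξ : ℝ => (2 * Real.pi)⁻¹ * ξ) volume volume := by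
    refine ⟨by fun_prop, ?_⟩
    rw [Real.map_volume_mul_left (by positivity)]
    exact Measure.smul_absolutelyContinuous
  have h1 : ((𝓕 (f.toLp 2 : L2) : L2) : ℝ → ℂ) =ᵐ[volume] (𝓕 f : 𝓢(ℝ, ℂ)) := by
    rw [SchwartzMap.toLp_fourier_eq]
    exact (𝓕 f).coeFn_toLp 2 volume
  filter_upwards [hq.ae_eq_comp h1] with ξ hξ
  simp only [Function.comp_apply] at hξ
  rw [hat, angularFourier, div_eq_inv_mul, hξ]

/-! ### Continuous functions on a compact frequency set -/

section zeroExtend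

variable {K : Set ℝ}

/-- Extension by zero of a continuous function on `K`. -/
def zeroExtend (φ : C(K, ℂ)) : ℝ → ℂ := Function.extend Subtype.val φ 0

theorem zeroExtend_of_mem (φ : C(K, ℂ)) {ξ : ℝ} (h : ξ ∈ K) : zeroExtend φ ξ = φ ⟨ξ, h⟩ :=
  Subtype.val_injective.extend_apply φ 0 ⟨ξ, h⟩

theorem zeroExtend_of_notMem (φ : C(K, ℂ)) {ξ : ℝ} (h : ξ ∉ K) : zeroExtend φ ξ = 0 :=
  Function.extend_apply' _ _ _ (by rintro ⟨a, rfl⟩; exact h a.2)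

theorem zeroExtend_add (φ χ : C(K, ℂ)) (ξ : ℝ) :
    zeroExtend (φ + χ) ξ = zeroExtend φ ξ + zeroExtend χ ξ := by
  by_cases h : ξ ∈ K
  · simp [zeroExtend_of_mem _ h]
  · simp [zeroExtend_of_notMem _ h]

theorem zeroExtend_smul (z : ℂ) (φ : C(K, ℂ)) (ξ : ℝ) :
    zeroExtend (z • φ) ξ = z * zeroExtend φ ξ := by
  by_cases h : ξ ∈ K
  · simp [zeroExtend_of_mem _ h]
  · simp [zeroExtend_of_notMem _ h]

variable [CompactSpace K]

/-- The extension of `1` is the indicator of `K`; this domination gives the operator bounds for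
`synthesis` and `synthesisAt`. -/
theorem norm_zeroExtend_le (φ : C(K, ℂ)) (ξ : ℝ) :
    ‖zeroExtend φ ξ‖ ≤ ‖φ‖ * ‖zeroExtend (1 : C(K, ℂ)) ξ‖ := by
  by_cases h : ξ ∈ K
  · simpa [zeroExtend_of_mem _ h] using φ.norm_coe_le_norm ⟨ξ, h⟩
  · simp [zeroExtend_of_notMem _ h]

theorem measurableSet_of_compactSpace : MeasurableSet K :=
  (isCompact_iff_compactSpace.2 inferInstance).measurableSet

theorem measurable_zeroExtend (φ : C(K, ℂ)) : Measurable (zeroExtend φ) :=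
  (MeasurableEmbedding.subtype_coe measurableSet_of_compactSpace).measurable_extend
    φ.continuous.measurable measurable_const

theorem memLp_zeroExtend (p : ℝ≥0∞) (φ : C(K, ℂ)) : MemLp (zeroExtend φ) p volume := by
  have hK : IsCompact K := isCompact_iff_compactSpace.2 inferInstance
  refine (memLp_indicator_const p hK.measurableSet (‖φ‖ : ℝ)
    (Or.inr hK.measure_lt_top.ne)).of_le (measurable_zeroExtend φ).aestronglyMeasurable
    (Filter.Eventually.of_forall fun ξ => ?_)
  by_cases h : ξ ∈ K
  · simpa [zeroExtend_of_mem _ h, h] using φ.norm_coe_le_norm ⟨ξ, h⟩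
  · simp [zeroExtend_of_notMem _ h]

theorem integrable_zeroExtend (φ : C(K, ℂ)) : Integrable (zeroExtend φ) :=
  memLp_one_iff_integrable.1 (memLp_zeroExtend 1 φ)

/-- `zeroExtend` in Mathlib's frequency variable, as a linear map into `L²`. -/
def rescaledZeroExtend (K : Set ℝ) [CompactSpace K] : C(K, ℂ) →ₗ[ℂ] L2 where
  toFun φ := (memLp_rescale (memLp_zeroExtend 2 φ)).toLp (rescale (zeroExtend φ))
  map_add' φ χ := by
    rw [← MemLp.toLp_add]
    congr 1
    funext ν
    simp only [rescale, zeroExtend_add, mul_add, Pi.add_apply]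
  map_smul' z φ := by
    rw [RingHom.id_apply, ← MemLp.toLp_const_smul]
    congr 1
    funext ν
    simp only [rescale, zeroExtend_smul, Pi.smul_apply, smul_eq_mul, mul_left_comm]

theorem rescaledZeroExtend_ae (φ : C(K, ℂ)) :
    (rescaledZeroExtend K φ : ℝ → ℂ) =ᵐ[volume] rescale (zeroExtend φ) :=
  (memLp_rescale (memLp_zeroExtend 2 φ)).coeFn_toLp

theorem norm_rescaledZeroExtend_le (φ : C(K, ℂ)) :
    ‖rescaledZeroExtend K φ‖ ≤ ‖rescaledZeroExtend K 1‖ * ‖φ‖ := by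
  rw [mul_comm]
  apply Lp.norm_le_mul_norm_of_ae_le_mul
  filter_upwards [rescaledZeroExtend_ae φ, rescaledZeroExtend_ae (1 : C(K, ℂ))] with ν h1 h2
  rw [h1, h2, rescale, rescale, norm_mul, norm_mul, mul_left_comm]
  exact mul_le_mul_of_nonneg_left (norm_zeroExtend_le φ _) (norm_nonneg _)

/-- The inverse Fourier transform of the extension by zero, as a bounded operator. -/
def synthesis (K : Set ℝ) [CompactSpace K] : C(K, ℂ) →L[ℂ] L2 :=
  (fourierInvCLM ℂ L2).comp
    ((rescaledZeroExtend K).mkContinuous ‖rescaledZeroExtend K 1‖ norm_rescaledZeroExtend_le)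

theorem synthesis_apply (φ : C(K, ℂ)) : synthesis K φ = invHat (zeroExtend φ) := by
  rw [invHat, dif_pos (memLp_rescale (memLp_zeroExtend 2 φ))]
  rfl

/-- `e^{ita}` as a continuous function on `K`. -/
def phaseFactor (K : Set ℝ) {a : ℝ → ℝ} (ha : Continuous a) (t : ℝ) : C(K, ℂ) :=
  ⟨fun ξ => Complex.exp (Complex.I * ((t * a ξ : ℝ) : ℂ)), by fun_prop⟩

theorem propagator_synthesis {a : ℝ → ℝ} (ha : Continuous a) (t : ℝ) (φ : C(K, ℂ)) :
    propagator a t (synthesis K φ) =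
      synthesis K (phaseFactor K ha t * φ) := by
  rw [synthesis_apply, propagator_invHat a t (memLp_zeroExtend 2 φ), synthesis_apply]
  congr 1
  funext ξ
  by_cases h : ξ ∈ K
  · simp [zeroExtend_of_mem _ h, phaseFactor]
  · simp [zeroExtend_of_notMem _ h]

/-- Evaluation at `x` of the inverse Fourier transform of the extension by zero. -/
def synthesisAt (K : Set ℝ) [CompactSpace K] (x : ℝ) : C(K, ℂ) →L[ℂ] ℂ :=
  LinearMap.mkContinuous
    { toFun := fun φ => (((√(2 * Real.pi))⁻¹ : ℝ) : ℂ) *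
        ∫ ξ, Complex.exp (Complex.I * ((x * ξ : ℝ) : ℂ)) * zeroExtend φ ξ
      map_add' := fun φ χ => by
        rw [← mul_add, ← integral_add]
        · simp only [zeroExtend_add, mul_add]
        all_goals
          refine (integrable_zeroExtend _).bdd_mul (c := 1) (by fun_prop) ?_
          exact Filter.Eventually.of_forall fun ξ => by
            rw [mul_comm Complex.I, Complex.norm_exp_ofReal_mul_I]
      map_smul' := fun z φ => by
        simp only [zeroExtend_smul, RingHom.id_apply, smul_eq_mul, mul_left_comm _ z]
        rw [integral_const_mul]
        ring }
    ((√(2 * Real.pi))⁻¹ * ∫ ξ, ‖zeroExtend (1 : C(K, ℂ)) ξ‖)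
    (fun φ => by
      simp only [LinearMap.coe_mk, AddHom.coe_mk]
      rw [norm_mul, Complex.norm_real, Real.norm_of_nonneg (by positivity), mul_assoc,
        ← integral_mul_const]
      refine mul_le_mul_of_nonneg_left (norm_integral_le_of_norm_le
        ((integrable_zeroExtend _).norm.mul_const _) ?_) (by positivity)
      refine Filter.Eventually.of_forall fun ξ => ?_
      rw [norm_mul, mul_comm Complex.I, Complex.norm_exp_ofReal_mul_I, one_mul, mul_comm]
      exact norm_zeroExtend_le φ ξ)

theorem synthesisAt_apply (x : ℝ) (φ : C(K, ℂ)) :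
    synthesisAt K x φ = (((√(2 * Real.pi))⁻¹ : ℝ) : ℂ) *
      ∫ ξ, Complex.exp (Complex.I * ((x * ξ : ℝ) : ℂ)) * zeroExtend φ ξ := rfl

theorem synthesis_ae (φ : C(K, ℂ)) :
    (synthesis K φ : ℝ → ℂ) =ᵐ[volume] fun x => synthesisAt K x φ := by
  rw [synthesis_apply]
  exact invHat_ae (integrable_zeroExtend φ) (memLp_zeroExtend 2 φ)

end zeroExtend

/-! ### Absence of space resonances: integration by parts in `η` -/

theorem hasDerivAt_slice_snd {F : Type*} [NormedAddCommGroup F] [NormedSpace ℝ F]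
    {Q : ℝ × ℝ → F} (hQ : ContDiff ℝ ∞ Q) (ξ η : ℝ) :
    HasDerivAt (fun y => Q (ξ, y)) (fderiv ℝ Q (ξ, η) (0, 1)) η :=
  ((hQ.differentiable (by simp)) (ξ, η)).hasFDerivAt.comp_hasDerivAt η
    ((hasDerivAt_const η ξ).prodMk (hasDerivAt_id η))

theorem hasDerivAt_slice_fst {F : Type*} [NormedAddCommGroup F] [NormedSpace ℝ F]
    {Q : ℝ × ℝ → F} (hQ : ContDiff ℝ ∞ Q) (ξ η : ℝ) :
    HasDerivAt (fun x => Q (x, η)) (fderiv ℝ Q (ξ, η) (1, 0)) ξ :=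
  ((hQ.differentiable (by simp)) (ξ, η)).hasFDerivAt.comp_hasDerivAt ξ
    ((hasDerivAt_id ξ).prodMk (hasDerivAt_const ξ η))

theorem contDiff_fderiv_const {E F : Type*} [NormedAddCommGroup E] [NormedSpace ℝ E]
    [NormedAddCommGroup F] [NormedSpace ℝ F] {Q : E → F} (hQ : ContDiff ℝ ∞ Q) (v : E) :
    ContDiff ℝ ∞ fun p => fderiv ℝ Q p v :=
  (hQ.fderiv_right (m := ∞) (by simp)).clm_apply contDiff_const

theorem hasCompactSupport_slice {F : Type*} [Zero F] {Q : ℝ × ℝ → F}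
    (hQ : HasCompactSupport Q) (ξ : ℝ) : HasCompactSupport fun η => Q (ξ, η) := by
  refine HasCompactSupport.of_support_subset_isCompact (hQ.isCompact.image continuous_snd) ?_
  intro η hη
  exact ⟨(ξ, η), subset_tsupport Q hη, rfl⟩

/-- One integration by parts in the second variable. -/
theorem exists_amplitude_mul_integral_exp {Φ : ℝ × ℝ → ℝ} (hΦ : ContDiff ℝ ∞ Φ)
    {H : ℝ × ℝ → ℂ} (hH : ContDiff ℝ ∞ H) (hHc : HasCompactSupport H)
    (hne : ∀ p ∈ tsupport H, fderiv ℝ Φ p (0, 1) ≠ 0) :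
    ∃ H₁ : ℝ × ℝ → ℂ, ContDiff ℝ ∞ H₁ ∧ HasCompactSupport H₁ ∧ tsupport H₁ ⊆ tsupport H ∧
      ∀ s ξ : ℝ, (s : ℂ) * ∫ η, Complex.exp (Complex.I * ((s * Φ (ξ, η) : ℝ) : ℂ)) * H (ξ, η) =
        ∫ η, Complex.exp (Complex.I * ((s * Φ (ξ, η) : ℝ) : ℂ)) * H₁ (ξ, η) := by
  set Φη : ℝ × ℝ → ℝ := fun p => fderiv ℝ Φ p (0, 1) with hΦη
  have cΦη : ContDiff ℝ ∞ Φη := contDiff_fderiv_const hΦ _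
  -- With `Q = H/∂_ηΦ`, one has `s e^{isΦ} H = -i ∂_η(e^{isΦ}) Q`, so the new amplitude is `i ∂_η
  -- Q`. Off the support of `H` the quotient is zero whatever the denominator, hence `Q` is smooth
  -- everywhere.
  set Q : ℝ × ℝ → ℂ := fun p => H p * (((Φη p)⁻¹ : ℝ) : ℂ) with hQ
  have tQ : tsupport Q ⊆ tsupport H := tsupport_mul_subset_left
  have cQ : ContDiff ℝ ∞ Q := by
    rw [contDiff_iff_contDiffAt]
    intro p
    by_cases hp : p ∈ tsupport H
    · exact hH.contDiffAt.mul
        (Complex.ofRealCLM.contDiff.contDiffAt.comp p (cΦη.contDiffAt.inv (hne p hp)))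
    · have : Q =ᶠ[nhds p] fun _ => 0 := by
        filter_upwards [(isClosed_tsupport H).isOpen_compl.mem_nhds hp] with q hq
        simp [hQ, image_eq_zero_of_notMem_tsupport hq]
      exact contDiffAt_const.congr_of_eventuallyEq this
  have hQc : HasCompactSupport Q := hHc.of_isClosed_subset (isClosed_tsupport Q) tQ
  have QH : ∀ p, (Φη p : ℂ) * Q p = H p := by
    intro p
    by_cases hp : p ∈ tsupport H
    · have : (Φη p : ℂ) ≠ 0 := Complex.ofReal_ne_zero.2 (hne p hp)
      simp only [hQ, Complex.ofReal_inv]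
      field_simp
    · simp [hQ, image_eq_zero_of_notMem_tsupport hp]
  set Q' : ℝ × ℝ → ℂ := fun p => fderiv ℝ Q p (0, 1) with hQ'
  have cQ' : ContDiff ℝ ∞ Q' := contDiff_fderiv_const cQ _
  have tQ' : tsupport Q' ⊆ tsupport Q := tsupport_fderiv_apply_subset ℝ (0, 1)
  have hQ'c : HasCompactSupport Q' := hQc.of_isClosed_subset (isClosed_tsupport Q') tQ'
  have tI : tsupport (fun p => Complex.I * Q' p) ⊆ tsupport Q' := tsupport_mul_subset_right
  refine ⟨fun p => Complex.I * Q' p, contDiff_const.mul cQ',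
    hQ'c.of_isClosed_subset (isClosed_tsupport _) tI, tI.trans (tQ'.trans tQ), fun s ξ => ?_⟩
  set e : ℝ → ℂ := fun η => Complex.exp (Complex.I * ((s * Φ (ξ, η) : ℝ) : ℂ)) with he
  have cΦ := hΦ.continuous
  have ce : Continuous e := by fun_prop
  have de : ∀ η, HasDerivAt e (e η * (Complex.I * ((s * Φη (ξ, η) : ℝ) : ℂ))) η := fun η =>
    ((((hasDerivAt_slice_snd hΦ ξ η).const_mul s).ofReal_comp).const_mul Complex.I).cexp
  have i1 : Integrable fun η => e η * H (ξ, η) :=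
    (ce.mul (hH.continuous.comp (by fun_prop))).integrable_of_hasCompactSupport
      (hasCompactSupport_slice hHc ξ).mul_left
  have i2 : Integrable fun η => e η * Q' (ξ, η) :=
    (ce.mul (cQ'.continuous.comp (by fun_prop))).integrable_of_hasCompactSupport
      (hasCompactSupport_slice hQ'c ξ).mul_left
  have i3 : Integrable fun η => e η * Q (ξ, η) :=
    (ce.mul (cQ.continuous.comp (by fun_prop))).integrable_of_hasCompactSupport
      (hasCompactSupport_slice hQc ξ).mul_left
  have d : ∀ η, HasDerivAt (fun η => e η * Q (ξ, η))
      (Complex.I * s * (e η * H (ξ, η)) + e η * Q' (ξ, η)) η := by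
    intro η
    convert! (de η).mul (hasDerivAt_slice_snd cQ ξ η) using 1
    rw [← QH]
    push_cast
    ring
  have h0 := integral_eq_zero_of_hasDerivAt_of_integrable d ((i1.const_mul _).add i2) i3
  rw [integral_add (i1.const_mul _) i2, integral_const_mul] at h0
  simp_rw [mul_left_comm _ Complex.I]
  rw [integral_const_mul]
  linear_combination (-Complex.I) * h0 + (s * ∫ η, e η * H (ξ, η)) * Complex.I_mul_I

/-- Repeated integration by parts in the second variable. -/
theorem exists_amplitude_pow_mul_integral_exp {Φ : ℝ × ℝ → ℝ} (hΦ : ContDiff ℝ ∞ Φ)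
    {H : ℝ × ℝ → ℂ} (hH : ContDiff ℝ ∞ H) (hHc : HasCompactSupport H)
    (hne : ∀ p ∈ tsupport H, fderiv ℝ Φ p (0, 1) ≠ 0) (k : ℕ) :
    ∃ H₁ : ℝ × ℝ → ℂ, ContDiff ℝ ∞ H₁ ∧ HasCompactSupport H₁ ∧ tsupport H₁ ⊆ tsupport H ∧
      ∀ s ξ : ℝ, (s : ℂ) ^ k *
          ∫ η, Complex.exp (Complex.I * ((s * Φ (ξ, η) : ℝ) : ℂ)) * H (ξ, η) =
        ∫ η, Complex.exp (Complex.I * ((s * Φ (ξ, η) : ℝ) : ℂ)) * H₁ (ξ, η) := by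
  induction k with
  | zero => exact ⟨H, hH, hHc, subset_rfl, fun s ξ => by simp⟩
  | succ k ih =>
    obtain ⟨H₁, c₁, k₁, t₁, e₁⟩ := ih
    obtain ⟨H₂, c₂, k₂, t₂, e₂⟩ :=
      exists_amplitude_mul_integral_exp hΦ c₁ k₁ fun p hp => hne p (t₁ hp)
    refine ⟨H₂, c₂, k₂, t₂.trans t₁, fun s ξ => ?_⟩
    rw [← e₂, ← e₁, pow_succ']
    ring

/-! ### Curvature of the phase and `t^{-1/2}` decay -/

/-- A continuous function without zeros on a compact set has none on a closed thickening, which is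
again compact. The margin `ρ` lets the bound hold on a whole interval in `ξ` that merely meets the
support. -/
theorem exists_pos_le_abs_of_ne_zero {P : ℝ × ℝ × ℝ → ℝ} (hP : Continuous P)
    {S : Set (ℝ × ℝ)} (hS : IsCompact S)
    (hne : ∀ ξ η σ : ℝ, (ξ, η) ∈ S → σ ∈ Set.Icc (0 : ℝ) 1 → P (ξ, η, σ) ≠ 0) :
    ∃ δ > 0, ∃ ρ > 0, ∀ ξ ξ' η σ : ℝ, (ξ, η) ∈ S → σ ∈ Set.Icc (0 : ℝ) 1 → |ξ' - ξ| ≤ ρ →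
      δ ≤ |P (ξ', η, σ)| := by
  set Z : Set (ℝ × ℝ × ℝ) :=
    (fun q : (ℝ × ℝ) × ℝ => (q.1.1, q.1.2, q.2)) '' (S ×ˢ Set.Icc (0 : ℝ) 1) with hZ
  have cZ : IsCompact Z := (hS.prod isCompact_Icc).image (by fun_prop)
  have hU : IsOpen {p | P p ≠ 0} := isOpen_ne_fun hP continuous_const
  have ZU : Z ⊆ {p | P p ≠ 0} := by
    rintro _ ⟨⟨⟨ξ, η⟩, σ⟩, ⟨h1, h2⟩, rfl⟩
    exact hne ξ η σ h1 h2
  obtain ⟨ρ, hρ, hsub⟩ := cZ.exists_cthickening_subset_open hU ZU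
  have cT : IsCompact (Metric.cthickening ρ Z) := cZ.cthickening
  rcases (Metric.cthickening ρ Z).eq_empty_or_nonempty with he | hn
  · refine ⟨1, one_pos, ρ, hρ, fun ξ ξ' η σ h1 h2 _ => ?_⟩
    have : (ξ, η, σ) ∈ Metric.cthickening ρ Z :=
      Metric.self_subset_cthickening Z ⟨((ξ, η), σ), ⟨h1, h2⟩, rfl⟩
    rw [he] at this
    exact this.elim
  · obtain ⟨p, hp, hmin⟩ := cT.exists_isMinOn hn (hP.abs.continuousOn)
    refine ⟨|P p|, abs_pos.2 (hsub hp), ρ, hρ, fun ξ ξ' η σ h1 h2 h3 => hmin ?_⟩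
    refine Metric.mem_cthickening_of_dist_le _ (ξ, η, σ) _ _ ⟨((ξ, η), σ), ⟨h1, h2⟩, rfl⟩ ?_
    simpa [Prod.dist_eq, Real.dist_eq, hρ.le] using h3

/-- The second `ξ`-derivative of `ψ(ξ, η, σ)`. -/
def curvature (a b : ℝ → ℝ) (p : ℝ × ℝ × ℝ) : ℝ :=
  (1 - p.2.2) * deriv (deriv a) p.1 + p.2.2 * deriv (deriv b) (p.1 - p.2.1)

theorem hasDerivAt_deriv {a : ℝ → ℝ} (ha : ContDiff ℝ ∞ a) (x : ℝ) :
    HasDerivAt a (deriv a x) x := (ha.differentiable (by simp) x).hasDerivAt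

theorem contDiff_deriv {a : ℝ → ℝ} (ha : ContDiff ℝ ∞ a) : ContDiff ℝ ∞ (deriv a) :=
  (contDiff_infty_iff_deriv.1 ha).2

theorem continuous_curvature {a b : ℝ → ℝ} (ha : ContDiff ℝ ∞ a) (hb : ContDiff ℝ ∞ b) :
    Continuous (curvature a b) := by
  have h1 := (contDiff_deriv (contDiff_deriv ha)).continuous
  have h2 := (contDiff_deriv (contDiff_deriv hb)).continuous
  unfold curvature
  fun_prop

section phase

variable {a b c : ℝ → ℝ}

theorem hasDerivAt_phase (ha : ContDiff ℝ ∞ a) (hb : ContDiff ℝ ∞ b) (x t s η ξ : ℝ) :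
    HasDerivAt (fun ξ => x * ξ + t * a ξ + s * Phi a b c ξ η)
      (x + t * deriv a ξ + s * (-deriv a ξ + deriv b (ξ - η))) ξ := by
  have h1 := (hasDerivAt_deriv hb (ξ - η)).comp_sub_const ξ η
  have h2 := (((hasDerivAt_deriv ha ξ).neg.add h1).add_const (c η)).const_mul s
  have h3 := (((hasDerivAt_id ξ).const_mul x).add ((hasDerivAt_deriv ha ξ).const_mul t)).add h2
  rw [mul_one] at h3
  exact h3

theorem hasDerivAt_deriv_phase (ha : ContDiff ℝ ∞ a) (hb : ContDiff ℝ ∞ b) (x t s η ξ : ℝ) :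
    HasDerivAt (fun ξ => x + t * deriv a ξ + s * (-deriv a ξ + deriv b (ξ - η)))
      (t * deriv (deriv a) ξ + s * (-deriv (deriv a) ξ + deriv (deriv b) (ξ - η))) ξ := by
  have h0 := hasDerivAt_deriv (contDiff_deriv ha) ξ
  have h1 := (hasDerivAt_deriv (contDiff_deriv hb) (ξ - η)).comp_sub_const ξ η
  have h2 := (h0.neg.add h1).const_mul s
  have h3 := ((h0.const_mul t).const_add x).add h2
  exact h3

/-- The parameter `X` multiplies a linear term, so it disappears: the lower bound on the curvature
is uniform in the position `x`. -/
theorem iteratedDeriv_two_psi (ha : ContDiff ℝ ∞ a) (hb : ContDiff ℝ ∞ b) (X ξ η σ : ℝ) :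
    iteratedDeriv 2 (fun ξ' => psi a b c X ξ' η σ) ξ = curvature a b (ξ, η, σ) := by
  have e : (fun ξ' => psi a b c X ξ' η σ) =
      fun ξ => X * ξ + 1 * a ξ + σ * Phi a b c ξ η := by
    funext ξ; simp only [psi]; ring
  rw [e, iteratedDeriv_succ, iteratedDeriv_one,
    funext fun ξ => (hasDerivAt_phase (c := c) ha hb X 1 σ η ξ).deriv,
    (hasDerivAt_deriv_phase ha hb X 1 σ η ξ).deriv, curvature]
  ring

theorem contDiff_Phi (ha : ContDiff ℝ ∞ a) (hb : ContDiff ℝ ∞ b) (hc : ContDiff ℝ ∞ c) :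
    ContDiff ℝ ∞ fun p : ℝ × ℝ => Phi a b c p.1 p.2 := by
  unfold Phi
  fun_prop

/-- Uniform `t^{-1/2}` decay of the oscillatory integral in `ξ`, for a fixed `η`. -/
theorem exists_norm_integral_phase_le (ha : ContDiff ℝ ∞ a) (hb : ContDiff ℝ ∞ b)
    (hc : ContDiff ℝ ∞ c) {A : ℝ × ℝ → ℂ} (hA : ContDiff ℝ ∞ A) (hAc : HasCompactSupport A)
    (hcurv : ∀ ξ η σ : ℝ, (ξ, η) ∈ tsupport A → σ ∈ Set.Icc (0 : ℝ) 1 →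
      curvature a b (ξ, η, σ) ≠ 0) :
    ∃ C : ℝ, 0 ≤ C ∧ ∀ x t s η : ℝ, 0 < t → 0 ≤ s → s ≤ t →
      ‖∫ ξ, Complex.exp (Complex.I * ((x * ξ + t * a ξ + s * Phi a b c ξ η : ℝ) : ℂ)) *
        A (ξ, η)‖ ≤ C / √t := by
  obtain ⟨δ, hδ, ρ, hρ, hcv⟩ :=
    exists_pos_le_abs_of_ne_zero (continuous_curvature ha hb) hAc.isCompact hcurv
  obtain ⟨B, hB⟩ := hA.continuous.bounded_above_of_compact_support hAc
  obtain ⟨B', hB'⟩ := (contDiff_fderiv_const hA (1, 0)).continuous.bounded_above_of_compact_support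
    (hAc.fderiv_apply ℝ (1, 0))
  have hB0 : 0 ≤ B := (norm_nonneg _).trans (hB 0)
  have hB'0 : 0 ≤ B' := (norm_nonneg _).trans (hB' 0)
  obtain ⟨R, hRpos, hR⟩ := hAc.isBounded.subset_closedBall_lt 0 (0 : ℝ × ℝ)
  -- The interval `[-R, R]` is cut into `n` pieces of length `L ≤ ρ`, with `n` independent of `x`,
  -- `t`, `s` and `η`.
  obtain ⟨n, hn⟩ := exists_nat_gt (2 * R / ρ)
  have hn0 : (0 : ℝ) < n := lt_of_le_of_lt (by positivity) hn
  set L : ℝ := 2 * R / n with hL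
  have hL0 : 0 < L := by positivity
  have hLρ : L ≤ ρ := by
    rw [hL, div_le_iff₀ hn0]
    rw [div_lt_iff₀ hρ] at hn
    linarith
  refine ⟨n * ((8 * B + B' * L) / √δ), by positivity, fun x t s η ht hs hst => ?_⟩
  have sA : ∀ ξ, ξ ∉ Set.Icc (-R) R → A (ξ, η) = 0 := by
    intro ξ hξ
    by_contra hne
    have h1 := hR (subset_tsupport A hne)
    rw [mem_closedBall_zero_iff, Prod.norm_def, max_le_iff] at h1
    exact hξ (abs_le.1 h1.1)
  set F : ℝ → ℂ := fun ξ =>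
    Complex.exp (Complex.I * ((x * ξ + t * a ξ + s * Phi a b c ξ η : ℝ) : ℂ)) * A (ξ, η) with hF
  have cF : Continuous F := by
    have h1 := ha.continuous
    have h2 := (contDiff_Phi ha hb hc).continuous
    have h3 := hA.continuous
    have h4 : Continuous fun ξ => Phi a b c ξ η :=
      h2.comp (by fun_prop : Continuous fun ξ : ℝ => (ξ, η))
    fun_prop
  set p : ℕ → ℝ := fun j => -R + j * L with hp
  have pn : p n = R := by
    simp only [hp, hL]; field_simp; ring
  have p0 : p 0 = -R := by simp [hp]
  have hstep : ∀ j, p (j + 1) - p j = L := fun j => by simp only [hp]; push_cast; ring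
  have e1 : ∫ ξ, F ξ = ∑ j ∈ Finset.range n, ∫ ξ in p j..p (j + 1), F ξ := by
    rw [intervalIntegral.sum_integral_adjacent_intervals fun j _ => cF.intervalIntegrable _ _,
      p0, pn, intervalIntegral.integral_of_le (by linarith), ← integral_Icc_eq_integral_Ioc]
    refine (setIntegral_eq_integral_of_forall_compl_eq_zero fun ξ hξ => ?_).symm
    simp [hF, sA ξ hξ]
  have piece : ∀ j, ‖∫ ξ in p j..p (j + 1), F ξ‖ ≤ (8 * B + B' * L) / √(t * δ) := by
    intro j
    have hle : p j ≤ p (j + 1) := by linarith [hstep j]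
    -- A piece that meets the support lies within `ρ` of a point of it, so the curvature bound holds
    -- on all of the piece; on any other piece the integrand vanishes.
    by_cases hex : ∃ ξ ∈ Set.Icc (p j) (p (j + 1)), (ξ, η) ∈ tsupport A
    · obtain ⟨ξ₀, hξ₀, hA₀⟩ := hex
      rw [← hstep j]
      have h1 := (contDiff_deriv (contDiff_deriv ha)).continuous
      have h2 := (contDiff_deriv (contDiff_deriv hb)).continuous
      refine norm_integral_exp_le_of_le_abs hle (by positivity)
        (hasDerivAt_phase (c := c) ha hb x t s η) (hasDerivAt_deriv_phase ha hb x t s η)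
        (by fun_prop) (fun ξ hξ => ?_) (fun ξ => hasDerivAt_slice_fst hA ξ η)
        ((contDiff_fderiv_const hA (1, 0)).continuous.comp (by fun_prop))
        (fun ξ => hB _) (fun ξ => hB' _)
      -- The second derivative of the phase is `t` times the curvature at `σ = s/t`; the condition
      -- `0 ≤ s ≤ t` is what puts `σ` in `[0, 1]`.
      have h3 := hcv ξ₀ ξ η (s / t) hA₀ ⟨by positivity, (div_le_one ht).2 hst⟩
        ((abs_le.2 ⟨by linarith [hξ.1, hξ₀.2, hstep j], by linarith [hξ.2, hξ₀.1, hstep j]⟩).trans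
          hLρ)
      have h4 : t * deriv (deriv a) ξ + s * (-deriv (deriv a) ξ + deriv (deriv b) (ξ - η)) =
          t * curvature a b (ξ, η, s / t) := by
        simp only [curvature]; field_simp; ring
      rw [h4, abs_mul, abs_of_pos ht]
      gcongr
    · push Not at hex
      have : ∫ ξ in p j..p (j + 1), F ξ = 0 := by
        rw [intervalIntegral.integral_congr (g := fun _ => (0 : ℂ))]
        · simp
        · intro ξ hξ
          rw [Set.uIcc_of_le hle] at hξ
          simp [hF, image_eq_zero_of_notMem_tsupport (hex ξ hξ)]
      rw [this, norm_zero]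
      positivity
  rw [e1]
  refine (norm_sum_le_of_le _ fun j _ => piece j).trans (le_of_eq ?_)
  rw [Finset.sum_const, Finset.card_range, nsmul_eq_mul, Real.sqrt_mul ht.le]
  field_simp

/-- Uniform `t^{-1/2}` decay of the oscillatory integral in `(ξ, η)`. -/
theorem exists_norm_integral_integral_phase_le (ha : ContDiff ℝ ∞ a) (hb : ContDiff ℝ ∞ b)
    (hc : ContDiff ℝ ∞ c) {A : ℝ × ℝ → ℂ} (hA : ContDiff ℝ ∞ A) (hAc : HasCompactSupport A)
    (hcurv : ∀ ξ η σ : ℝ, (ξ, η) ∈ tsupport A → σ ∈ Set.Icc (0 : ℝ) 1 →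
      curvature a b (ξ, η, σ) ≠ 0) :
    ∃ C : ℝ, 0 ≤ C ∧ ∀ x t s : ℝ, 0 < t → 0 ≤ s → s ≤ t →
      ‖∫ ξ, Complex.exp (Complex.I * ((x * ξ + t * a ξ : ℝ) : ℂ)) *
        ∫ η, Complex.exp (Complex.I * ((s * Phi a b c ξ η : ℝ) : ℂ)) * A (ξ, η)‖ ≤ C / √t := by
  obtain ⟨C, hC, hbd⟩ := exists_norm_integral_phase_le ha hb hc hA hAc hcurv
  obtain ⟨R, hRpos, hR⟩ := hAc.isBounded.subset_closedBall_lt 0 (0 : ℝ × ℝ)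
  refine ⟨C * (2 * R), by positivity, fun x t s ht hs hst => ?_⟩
  set F : ℝ → ℝ → ℂ := fun ξ η =>
    Complex.exp (Complex.I * ((x * ξ + t * a ξ + s * Phi a b c ξ η : ℝ) : ℂ)) * A (ξ, η) with hF
  have cF : Continuous F.uncurry := by
    have h1 := ha.continuous
    have h2 := (contDiff_Phi ha hb hc).continuous
    have h3 := hA.continuous
    simp only [hF, Function.uncurry_def]
    fun_prop
  have kF : HasCompactSupport F.uncurry := by
    refine HasCompactSupport.of_support_subset_isCompact hAc.isCompact ?_
    rintro ⟨ξ, η⟩ hp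
    exact subset_tsupport A (right_ne_zero_of_mul hp)
  have e1 : ∫ ξ, Complex.exp (Complex.I * ((x * ξ + t * a ξ : ℝ) : ℂ)) *
        ∫ η, Complex.exp (Complex.I * ((s * Phi a b c ξ η : ℝ) : ℂ)) * A (ξ, η) =
      ∫ ξ, ∫ η, F ξ η := by
    refine integral_congr_ae (Filter.Eventually.of_forall fun ξ => ?_)
    simp only
    rw [← integral_const_mul]
    refine integral_congr_ae (Filter.Eventually.of_forall fun η => ?_)
    simp only [hF]
    rw [← mul_assoc, ← Complex.exp_add]
    push_cast
    ring_nf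
  -- After Fubini the bound for fixed `η` is integrated over `[-R, R]`, whence the factor `2 * R`.
  rw [e1, integral_integral_swap_of_hasCompactSupport cF kF]
  have sA : ∀ η, η ∉ Set.Icc (-R) R → ∀ ξ, A (ξ, η) = 0 := by
    intro η hη ξ
    by_contra hne
    have h1 := hR (subset_tsupport A hne)
    rw [mem_closedBall_zero_iff, Prod.norm_def, max_le_iff] at h1
    exact hη (abs_le.1 h1.2)
  rw [← setIntegral_eq_integral_of_forall_compl_eq_zero (s := Set.Icc (-R) R)
    (fun η hη => by simp [hF, sA η hη])]
  refine (norm_setIntegral_le_of_norm_le_const (C := C / √t) measure_Icc_lt_top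
    fun η _ => hbd x t s η ht hs hst).trans (le_of_eq ?_)
  rw [Real.volume_real_Icc_of_le (by linarith)]
  ring

end phase

/-! ### The interaction in Fourier variables -/

theorem isClosed_symbolSupport (m : ℝ × ℝ → ℂ) : IsClosed (symbolSupport m) :=
  (isClosed_tsupport m).preimage (by fun_prop : Continuous fun p : ℝ × ℝ => (p.1 - p.2, p.2))

theorem isCompact_symbolSupport {m : ℝ × ℝ → ℂ} (hmc : HasCompactSupport m) :
    IsCompact (symbolSupport m) := by
  refine (hmc.isCompact.image
    (by fun_prop : Continuous fun p : ℝ × ℝ => (p.1 + p.2, p.2))).of_isClosed_subset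
    (isClosed_symbolSupport m) ?_
  rintro ⟨ξ, η⟩ hp
  exact ⟨(ξ - η, η), hp, by simp⟩

/-- The amplitude `m(ξ-η,η) f̂(ξ-η) ĝ(η)` of the interaction. -/
def amplitude (m : ℝ × ℝ → ℂ) (f g : 𝓢(ℝ, ℂ)) (p : ℝ × ℝ) : ℂ :=
  m (p.1 - p.2, p.2) * angularFourier f (p.1 - p.2) * angularFourier g p.2

theorem contDiff_amplitude {m : ℝ × ℝ → ℂ} (hm : ContDiff ℝ ∞ m) (f g : 𝓢(ℝ, ℂ)) :
    ContDiff ℝ ∞ (amplitude m f g) := by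
  have h1 := contDiff_angularFourier f
  have h2 := contDiff_angularFourier g
  unfold amplitude
  fun_prop

theorem tsupport_amplitude_subset (m : ℝ × ℝ → ℂ) (f g : 𝓢(ℝ, ℂ)) :
    tsupport (amplitude m f g) ⊆ symbolSupport m := by
  refine closure_minimal (fun p hp => ?_) (isClosed_symbolSupport m)
  exact subset_tsupport m (left_ne_zero_of_mul (left_ne_zero_of_mul hp))

theorem hasCompactSupport_amplitude {m : ℝ × ℝ → ℂ} (hmc : HasCompactSupport m)
    (f g : 𝓢(ℝ, ℂ)) : HasCompactSupport (amplitude m f g) :=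
  (isCompact_symbolSupport hmc).of_isClosed_subset (isClosed_tsupport _)
    (tsupport_amplitude_subset m f g)

/-- The oscillatory integral `∫ e^{isΦ(ξ,η)} H(ξ,η) dη`. -/
def oscillation (Φ : ℝ × ℝ → ℝ) (H : ℝ × ℝ → ℂ) (p : ℝ × ℝ) : ℂ :=
  ∫ η, Complex.exp (Complex.I * ((p.1 * Φ (p.2, η) : ℝ) : ℂ)) * H (p.2, η)

theorem continuous_oscillation {Φ : ℝ × ℝ → ℝ} {H : ℝ × ℝ → ℂ} (hΦ : Continuous Φ)
    (hH : Continuous H) (hHc : HasCompactSupport H) : Continuous (oscillation Φ H) := by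
  have hK : IsCompact (Prod.snd '' tsupport H) := hHc.isCompact.image continuous_snd
  have e : oscillation Φ H = fun p => ∫ η in Prod.snd '' tsupport H,
      Complex.exp (Complex.I * ((p.1 * Φ (p.2, η) : ℝ) : ℂ)) * H (p.2, η) := by
    funext p
    refine (setIntegral_eq_integral_of_forall_compl_eq_zero fun η hη => ?_).symm
    rw [image_eq_zero_of_notMem_tsupport fun h => hη ⟨_, h, rfl⟩, mul_zero]
  rw [e]
  refine continuous_parametric_integral_of_continuous ?_ hK
  simp only [Function.uncurry_def]
  fun_prop

theorem oscillation_eq_zero {Φ : ℝ × ℝ → ℝ} {H : ℝ × ℝ → ℂ} {K : Set ℝ}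
    (hK : Prod.fst '' tsupport H ⊆ K) (s : ℝ) {ξ : ℝ} (hξ : ξ ∉ K) :
    oscillation Φ H (s, ξ) = 0 := by
  have : ∀ η, H (ξ, η) = 0 := fun η =>
    image_eq_zero_of_notMem_tsupport fun h => hξ (hK ⟨_, h, rfl⟩)
  simp [oscillation, this]

/-- The oscillatory integral at time `s`, as a continuous function on `K`. -/
def profile (K : Set ℝ) {Φ : ℝ × ℝ → ℝ} {H : ℝ × ℝ → ℂ} (h : Continuous (oscillation Φ H)) :
    C(ℝ, C(K, ℂ)) :=
  ContinuousMap.curry ⟨fun p : ℝ × K => oscillation Φ H (p.1, p.2), by fun_prop⟩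

theorem zeroExtend_phaseFactor_mul_profile {K : Set ℝ} {Φ : ℝ × ℝ → ℝ} {H : ℝ × ℝ → ℂ}
    (hK : Prod.fst '' tsupport H ⊆ K) (h : Continuous (oscillation Φ H)) {a : ℝ → ℝ}
    (ha : Continuous a) (t s ξ : ℝ) :
    zeroExtend (phaseFactor K ha t * profile K h s) ξ =
      Complex.exp (Complex.I * ((t * a ξ : ℝ) : ℂ)) * oscillation Φ H (s, ξ) := by
  by_cases hξ : ξ ∈ K
  · rw [zeroExtend_of_mem _ hξ]
    rfl
  · rw [zeroExtend_of_notMem _ hξ, oscillation_eq_zero hK s hξ, mul_zero]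

/-- The input phases add up to `b(ξ-η) + c(η) = a(ξ) + Φ(ξ,η)`, and `e^{isa(ξ)}` leaves the
`η`-integral. -/
theorem pseudoProduct_propagator {a b c : ℝ → ℝ} (ha : Continuous a) (hb : Continuous b)
    (hc : Continuous c) (m : ℝ × ℝ → ℂ) (f g : 𝓢(ℝ, ℂ)) {K : Set ℝ} [CompactSpace K]
    (hK : Prod.fst '' tsupport (amplitude m f g) ⊆ K)
    (h : Continuous (oscillation (fun p => Phi a b c p.1 p.2) (amplitude m f g))) (s : ℝ) :
    pseudoProduct m (propagator b s (f.toLp 2)) (propagator c s (g.toLp 2)) =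
      synthesis K (phaseFactor K ha s *
        profile K h s) := by
  rw [synthesis_apply, pseudoProduct]
  congr 1
  funext ξ
  rw [zeroExtend_phaseFactor_mul_profile hK h, oscillation, ← integral_const_mul]
  have h1 : ∀ᵐ η : ℝ, hat (propagator b s (f.toLp 2)) η =
      Complex.exp (Complex.I * ((s * b η : ℝ) : ℂ)) * angularFourier f η := by
    filter_upwards [hat_propagator hb s (f.toLp 2), hat_toLp_ae f] with η h1 h2
    rw [h1, h2]
  have h2 : ∀ᵐ η : ℝ, hat (propagator c s (g.toLp 2)) η =
      Complex.exp (Complex.I * ((s * c η : ℝ) : ℂ)) * angularFourier g η := by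
    filter_upwards [hat_propagator hc s (g.toLp 2), hat_toLp_ae g] with η h1 h2
    rw [h1, h2]
  have h3 := (Measure.measurePreserving_sub_left volume ξ).quasiMeasurePreserving.ae h1
  refine integral_congr_ae ?_
  filter_upwards [h2, h3] with η h2 h3
  rw [h2, h3]
  have e1 : Complex.I * ((s * a ξ : ℝ) : ℂ) + Complex.I * ((s * Phi a b c ξ η : ℝ) : ℂ) =
      Complex.I * ((s * b (ξ - η) : ℝ) : ℂ) + Complex.I * ((s * c η : ℝ) : ℂ) := by
    simp only [Phi]
    push_cast
    ring
  have e2 := congrArg Complex.exp e1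
  rw [Complex.exp_add, Complex.exp_add] at e2
  simp only [amplitude]
  linear_combination
    (-(m (ξ - η, η) * angularFourier f (ξ - η) * angularFourier g η)) * e2

/-- Since `e^{i(t-s)a} e^{isa} = e^{ita}`, the Duhamel integrand depends on `s` only through the
profile. -/
theorem propagator_pseudoProduct_propagator {a b c : ℝ → ℝ} (ha : Continuous a)
    (hb : Continuous b) (hc : Continuous c) (m : ℝ × ℝ → ℂ) (f g : 𝓢(ℝ, ℂ)) {K : Set ℝ}
    [CompactSpace K] (hK : Prod.fst '' tsupport (amplitude m f g) ⊆ K)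
    (h : Continuous (oscillation (fun p => Phi a b c p.1 p.2) (amplitude m f g))) (t s : ℝ) :
    propagator a (t - s)
        (pseudoProduct m (propagator b s (f.toLp 2)) (propagator c s (g.toLp 2))) =
      synthesis K (phaseFactor K ha t *
        profile K h s) := by
  rw [pseudoProduct_propagator ha hb hc m f g hK h, propagator_synthesis ha]
  congr 1
  ext ξ
  simp only [ContinuousMap.mul_apply, phaseFactor, ContinuousMap.coe_mk]
  rw [← mul_assoc, ← Complex.exp_add]
  congr 2
  push_cast
  ring

/-! ### Decay of the integrand and integration in time -/

/-- Decay of the inverse Fourier transform of the profile, transported by the group. -/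
theorem exists_pow_mul_norm_synthesisAt_le {a b c : ℝ → ℝ} (ha : ContDiff ℝ ∞ a)
    (hb : ContDiff ℝ ∞ b) (hc : ContDiff ℝ ∞ c) {H : ℝ × ℝ → ℂ} (hH : ContDiff ℝ ∞ H)
    (hHc : HasCompactSupport H)
    (hspace : ∀ p ∈ tsupport H, fderiv ℝ (fun p : ℝ × ℝ => Phi a b c p.1 p.2) p (0, 1) ≠ 0)
    (hcurv : ∀ ξ η σ : ℝ, (ξ, η) ∈ tsupport H → σ ∈ Set.Icc (0 : ℝ) 1 →
      curvature a b (ξ, η, σ) ≠ 0)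
    {K : Set ℝ} [CompactSpace K] (hK : Prod.fst '' tsupport H ⊆ K)
    (h : Continuous (oscillation (fun p => Phi a b c p.1 p.2) H)) (k : ℕ) :
    ∃ C : ℝ, 0 ≤ C ∧ ∀ x t s : ℝ, 0 < t → 0 ≤ s → s ≤ t →
      s ^ k * ‖synthesisAt K x (phaseFactor K ha.continuous t * profile K h s)‖ ≤
        C / √t := by
  obtain ⟨A, cA, kA, tA, eA⟩ :=
    exists_amplitude_pow_mul_integral_exp (contDiff_Phi ha hb hc) hH hHc hspace k
  obtain ⟨C, hC, hbd⟩ := exists_norm_integral_integral_phase_le ha hb hc cA kA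
    fun ξ η σ hp => hcurv ξ η σ (tA hp)
  refine ⟨(√(2 * Real.pi))⁻¹ * C, by positivity, fun x t s ht hs hst => ?_⟩
  have e1 : (s : ℂ) ^ k * ∫ ξ, Complex.exp (Complex.I * ((x * ξ : ℝ) : ℂ)) *
      zeroExtend (phaseFactor K ha.continuous t * profile K h s) ξ =
      ∫ ξ, Complex.exp (Complex.I * ((x * ξ + t * a ξ : ℝ) : ℂ)) *
        ∫ η, Complex.exp (Complex.I * ((s * Phi a b c ξ η : ℝ) : ℂ)) * A (ξ, η) := by
    rw [← integral_const_mul]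
    refine integral_congr_ae (Filter.Eventually.of_forall fun ξ => ?_)
    simp only
    rw [← eA s ξ, zeroExtend_phaseFactor_mul_profile hK h, oscillation, Complex.ofReal_add,
      mul_add, Complex.exp_add]
    ring
  have e2 := hbd x t s ht hs hst
  rw [← e1, norm_mul, norm_pow, Complex.norm_real, Real.norm_of_nonneg hs] at e2
  rw [synthesisAt_apply, norm_mul, Complex.norm_real, Real.norm_of_nonneg (by positivity),
    mul_left_comm, mul_div_assoc]
  exact mul_le_mul_of_nonneg_left e2 (by positivity)

/-- The two weights combine into the majorant `M^{-N} (1 + s²)^{-1}`, of integral at most `π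
M^{-N}`. The weight `s^{N+2}` alone would give `M^{-N-1}`, which is too large for small `M`. -/
theorem norm_integral_le_of_pow_mul_le {F : ℝ → ℂ} {M t D D' : ℝ} {N : ℕ} (hM : 0 < M)
    (hMt : M ≤ t) (h1 : ∀ s, M ≤ s → s ≤ t → s ^ N * ‖F s‖ ≤ D)
    (h2 : ∀ s, M ≤ s → s ≤ t → s ^ (N + 2) * ‖F s‖ ≤ D') :
    ‖∫ s in M..t, F s‖ ≤ 4 * (D + D') / M ^ N := by
  have hb : ∀ s ∈ Set.Ioc M t, ‖F s‖ ≤ (D + D') / M ^ N * (1 + s ^ 2)⁻¹ := by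
    intro s hs
    have hs0 : 0 < s := hM.trans hs.1
    have h3 := add_le_add (h1 s hs.1.le hs.2) (h2 s hs.1.le hs.2)
    rw [← div_eq_mul_inv, div_div, le_div_iff₀ (by positivity)]
    calc ‖F s‖ * (M ^ N * (1 + s ^ 2)) ≤ ‖F s‖ * (s ^ N * (1 + s ^ 2)) := by
          have := hs.1.le
          gcongr
      _ = s ^ N * ‖F s‖ + s ^ (N + 2) * ‖F s‖ := by ring
      _ ≤ _ := h3
  have hD : 0 ≤ D + D' := by
    have h3 := h1 M le_rfl hMt
    have h4 := h2 M le_rfl hMt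
    have h5 : 0 ≤ M ^ N * ‖F M‖ := by positivity
    have h6 : 0 ≤ M ^ (N + 2) * ‖F M‖ := by positivity
    linarith
  have hc : Continuous fun s : ℝ => (D + D') / M ^ N * (1 + s ^ 2)⁻¹ :=
    continuous_const.mul ((by fun_prop : Continuous fun s : ℝ => 1 + s ^ 2).inv₀
      fun s => by positivity)
  refine (intervalIntegral.norm_integral_le_of_norm_le hMt (Filter.Eventually.of_forall hb)
    (hc.intervalIntegrable M t)).trans ?_
  rw [intervalIntegral.integral_const_mul, integral_inv_one_add_sq, mul_comm 4, mul_div_right_comm]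
  gcongr
  have h3 := Real.arctan_lt_pi_div_two t
  have h4 := Real.neg_pi_div_two_lt_arctan M
  have h5 := Real.pi_lt_d2
  linarith

theorem fderiv_Phi_snd {a b c : ℝ → ℝ} (ha : ContDiff ℝ ∞ a) (hb : ContDiff ℝ ∞ b)
    (hc : ContDiff ℝ ∞ c) (ξ η : ℝ) :
    fderiv ℝ (fun p : ℝ × ℝ => Phi a b c p.1 p.2) (ξ, η) (0, 1) =
      deriv (fun η' => Phi a b c ξ η') η :=
  (hasDerivAt_slice_snd (contDiff_Phi ha hb hc) ξ η).deriv.symm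

end Dispersive

end

/-! ### The main theorem -/

open Dispersive in
theorem theorem2p3
    (a b c : ℝ → ℝ) (ha : ContDiff ℝ ∞ a) (hb : ContDiff ℝ ∞ b) (hc : ContDiff ℝ ∞ c)
    (Ha : SecondDerivBoundedAway a) (Hb : SecondDerivBoundedAway b)
    (Hc : SecondDerivBoundedAway c)
    (m : ℝ × ℝ → ℂ) (hm : ContDiff ℝ ∞ m) (hmc : HasCompactSupport m)
    (hspace : ∀ ξ η : ℝ, (ξ, η) ∈ symbolSupport m → deriv (fun η' => Phi a b c ξ η') η ≠ 0)
    (hcurv : ∀ X ξ η σ : ℝ, (ξ, η) ∈ symbolSupport m → σ ∈ Set.Icc (0 : ℝ) 1 →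
      iteratedDeriv 2 (fun ξ' => psi a b c X ξ' η σ) ξ ≠ 0)
    (f g : 𝓢(ℝ, ℂ)) (u v w : ℝ → L2)
    (hsol : IsSolution a b c m (f.toLp 2) (g.toLp 2) u v w) :
    (∀ t T : ℝ, 0 ≤ T → IntervalIntegrable
      (fun s => propagator a (t - s) (pseudoProduct m (v s) (w s))) volume 0 T) ∧
    (∀ M t : ℝ, 0 < M → M ≤ t →
      propagator a t (truncatedProfile a (fun s => pseudoProduct m (v s) (w s)) M)
        = duhamel a ((Set.Iio M).indicator fun s => pseudoProduct m (v s) (w s)) t) ∧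
    ∀ N : ℕ, ∃ C : ℝ, ∀ M t : ℝ, 0 < M → M ≤ t → ∀ᵐ x : ℝ,
      ‖u t x - propagator a t (truncatedProfile a (fun s => pseudoProduct m (v s) (w s)) M) x‖
        ≤ C / (M ^ N * √t) := by
  set H := amplitude m f g with hHdef
  have hH : ContDiff ℝ ∞ H := contDiff_amplitude hm f g
  have hHc : HasCompactSupport H := hasCompactSupport_amplitude hmc f g
  have hHm : tsupport H ⊆ symbolSupport m := tsupport_amplitude_subset m f g
  set K : Set ℝ := Prod.fst '' tsupport H with hKdef
  have : CompactSpace K := isCompact_iff_compactSpace.1 (hHc.isCompact.image continuous_fst)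
  have hosc : Continuous (oscillation (fun p => Phi a b c p.1 p.2) H) :=
    continuous_oscillation (contDiff_Phi ha hb hc).continuous hH.continuous hHc
  set U : ℝ → C(K, ℂ) := phaseFactor K ha.continuous with hU
  set P := profile K hosc with hP
  set J : ℝ → ℝ → L2 := fun t s => synthesis K (U t * P s) with hJ
  have cUP : ∀ t, Continuous fun s => U t * P s := fun t => continuous_const.mul P.continuous
  have cJ : ∀ t, Continuous (J t) := fun t => (synthesis K).continuous.comp (cUP t)
  -- The functions `v` and `w` are prescribed only for nonnegative times, hence the restriction on
  -- `s`.
  have key : ∀ t s, 0 ≤ s → propagator a (t - s) (pseudoProduct m (v s) (w s)) = J t s := by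
    intro t s hs
    rw [hsol.eq_v s hs, hsol.eq_w s hs]
    exact propagator_pseudoProduct_propagator ha.continuous hb.continuous hc.continuous m f g
      subset_rfl hosc t s
  have hduh : ∀ t, 0 ≤ t → u t = -Complex.I • ∫ s in (0 : ℝ)..t, J t s := by
    intro t ht
    rw [hsol.eq_u t ht, duhamel]
    congr 1
    refine intervalIntegral.integral_congr fun s hs => ?_
    rw [Set.uIcc_of_le ht] at hs
    exact key t s hs.1
  have htr : ∀ t M, 0 ≤ M →
      propagator a t (truncatedProfile a (fun s => pseudoProduct m (v s) (w s)) M) =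
        -Complex.I • ∫ s in (0 : ℝ)..M, J t s := by
    intro t M hM
    have hU0 : U 0 = 1 := by
      ext ξ
      simp [hU, phaseFactor]
    have e1 : truncatedProfile a (fun s => pseudoProduct m (v s) (w s)) M =
        synthesis K (-Complex.I • ∫ s in (0 : ℝ)..M, P s) := by
      rw [map_smul, ← ContinuousLinearMap.intervalIntegral_comp_comm _
        (P.continuous.intervalIntegrable 0 M), truncatedProfile]
      congr 1
      refine intervalIntegral.integral_congr fun s hs => ?_
      rw [Set.uIcc_of_le hM] at hs
      have := key 0 s hs.1
      rw [zero_sub] at this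
      simp only [this, hJ, hU0, one_mul]
    -- The integral was formed in `C(K, ℂ)`, so `e^{ita(D)}` acts as multiplication by `U t`, which
    -- passes under it.
    rw [e1, propagator_synthesis ha.continuous]
    change synthesis K (U t * (-Complex.I • ∫ s in (0 : ℝ)..M, P s)) = _
    have e2 := (ContinuousLinearMap.mul ℂ C(K, ℂ) (U t)).intervalIntegral_comp_comm
      (P.continuous.intervalIntegrable (μ := volume) 0 M)
    simp only [ContinuousLinearMap.mul_apply'] at e2
    rw [mul_smul_comm, map_smul, ← e2,
      ← ContinuousLinearMap.intervalIntegral_comp_comm _ ((cUP t).intervalIntegrable 0 M)]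
  have hprop0 : ∀ t, propagator a t 0 = 0 := by
    intro t
    have := propagator_synthesis ha.continuous t (0 : C(K, ℂ))
    simpa using this
  refine ⟨fun t T hT => ?_, fun M t hM hMt => ?_, fun N => ?_⟩
  · refine ((cJ t).intervalIntegrable 0 T).congr fun s hs => ?_
    rw [Set.uIoc_of_le hT] at hs
    exact (key t s hs.1.le).symm
  · rw [htr t M hM.le, duhamel]
    congr 1
    have e0 : ∫ s in (0 : ℝ)..t, propagator a (t - s)
        ((Set.Iio M).indicator (fun s => pseudoProduct m (v s) (w s)) s) =
        ∫ s in (0 : ℝ)..t, (Set.Iio M).indicator (J t) s := by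
      refine intervalIntegral.integral_congr fun s hs => ?_
      rw [Set.uIcc_of_le (hM.le.trans hMt)] at hs
      by_cases hsM : s ∈ Set.Iio M
      · simp only [Set.indicator_of_mem hsM, key t s hs.1]
      · simp only [Set.indicator_of_notMem hsM, hprop0]
    -- The cutoff `s < M` excludes the endpoint `M`, a null set: hence the passage from `Ioc` to
    -- `Ioo`.
    rw [e0, intervalIntegral.integral_of_le (hM.le.trans hMt),
      intervalIntegral.integral_of_le hM.le, setIntegral_indicator measurableSet_Iio,
      integral_Ioc_eq_integral_Ioo]
    congr 2
    ext s
    simp only [Set.mem_Ioo, Set.mem_inter_iff, Set.mem_Ioc, Set.mem_Iio]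
    exact ⟨fun h => ⟨⟨h.1, h.2.le.trans hMt⟩, h.2⟩, fun h => ⟨h.1.1, h.2⟩⟩
  · have hs' : ∀ p ∈ tsupport H,
        fderiv ℝ (fun p : ℝ × ℝ => Phi a b c p.1 p.2) p (0, 1) ≠ 0 := by
      rintro ⟨ξ, η⟩ hp
      rw [fderiv_Phi_snd ha hb hc]
      exact hspace ξ η (hHm hp)
    have hc' : ∀ ξ η σ : ℝ, (ξ, η) ∈ tsupport H → σ ∈ Set.Icc (0 : ℝ) 1 →
        curvature a b (ξ, η, σ) ≠ 0 := by
      intro ξ η σ hp hσ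
      rw [← iteratedDeriv_two_psi (c := c) ha hb 0]
      exact hcurv 0 ξ η σ (hHm hp) hσ
    obtain ⟨C₁, -, h₁⟩ := exists_pow_mul_norm_synthesisAt_le ha hb hc hH hHc hs' hc'
      subset_rfl hosc N
    obtain ⟨C₂, -, h₂⟩ := exists_pow_mul_norm_synthesisAt_le ha hb hc hH hHc hs' hc'
      subset_rfl hosc (N + 2)
    refine ⟨4 * (C₁ + C₂), fun M t hM hMt => ?_⟩
    have ht : 0 < t := hM.trans_le hMt
    have e1 : u t - propagator a t
        (truncatedProfile a (fun s => pseudoProduct m (v s) (w s)) M) =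
        synthesis K (-Complex.I • ∫ s in M..t, U t * P s) := by
      rw [hduh t ht.le, htr t M hM.le, ← smul_sub, intervalIntegral.integral_interval_sub_left
        ((cJ t).intervalIntegrable _ _) ((cJ t).intervalIntegrable _ _), map_smul,
        ← ContinuousLinearMap.intervalIntegral_comp_comm _ ((cUP t).intervalIntegrable M t)]
    -- The exceptional null set in `x` is chosen after the integration in `s`. Off it, the value at
    -- `x` is the bounded functional `synthesisAt K x`, which passes under the integral.
    filter_upwards [Lp.coeFn_sub (u t) (propagator a t
      (truncatedProfile a (fun s => pseudoProduct m (v s) (w s)) M)),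
      synthesis_ae (-Complex.I • ∫ s in M..t, U t * P s)] with x hx1 hx2
    rw [← Pi.sub_apply, ← hx1, e1, hx2, map_smul, norm_smul, norm_neg, Complex.norm_I, one_mul,
      ← ContinuousLinearMap.intervalIntegral_comp_comm _ ((cUP t).intervalIntegrable M t)]
    refine (norm_integral_le_of_pow_mul_le (D := C₁ / √t) (D' := C₂ / √t) hM hMt
      (fun s hs hst => h₁ x t s ht (hM.le.trans hs) hst)
      (fun s hs hst => h₂ x t s ht (hM.le.trans hs) hst)).trans (le_of_eq ?_)
    have := Real.sqrt_pos.2 ht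
    field_simp
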